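/- Let $n,m\ge 1$ be integers and let $M_{n,m}(\mathbb{R})$ be the space of real $n\times m$ matrices with inner product $x\cdot y=\operatorname{tr}(x^{T}y)$ and $nm$-dimensional volume $V_{nm}$; identify $\mathbb{R}^n$ with $M_{n,1}(\mathbb{R})$. Let $\Phi:M_{1,m}(\mathbb{R})\to[0,\infty)$ be a convex function with $\Phi(o)=0$ and $\Phi(z)+\Phi(-z)>0$ for all $z\neq o$. For a compact convex set $K\subset\mathbb{R}^n$ containing the origin in its interior, let $h_K(u)=\max_{y\in K}u\cdot y$ be its support function, let $V_n(K)$ be its volume, and let $S_K$ be its surface area measure, i.e. $S_K(\eta)=\mathcal{H}^{n-1}(\nu_K^{-1}(\eta))$ for Borel sets $\eta\subset S^{n-1}$, where $\nu_K(y)$ is an outer unit normal vector of $K$ at $y\in\partial K$. The $m$th order Orlicz projection body $\Pi_\Phi^m K\subset M_{n,m}(\mathbb{R})$ is the convex body with support function $$h_{\Pi_\Phi^m K}(x)=\inf\left\{\frac1t>0:\ \int_{S^{n-1}}\Phi\left(t\,\frac{u^{T}x}{h_K(u)}\right)h_K(u)\,dS_K(u)\le nV_n(K)\right\},\qquad x\in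 M_{n,m}(\mathbb{R}),$$ that is, $\Pi_\Phi^m K=\{y\in M_{n,m}(\mathbb{R}): x\cdot y\le h_{\Pi_\Phi^m K}(x)\text{ for all }x\in M_{n,m}(\mathbb{R})\}$. Its polar body is $\Pi_\Phi^{m,*}K=\{x\in M_{n,m}(\mathbb{R}): x\cdot y\le 1\text{ for all }y\in\Pi_\Phi^m K\}$. Then, for every such $K$ and every $A\in SL(n)$, $$\Pi_\Phi^m(AK)=A^{-T}\,\Pi_\Phi^m K=\{(A^{T})^{-1}y:\ y\in\Pi_\Phi^m K\},$$ and hence $$V_{nm}\big(\Pi_\Phi^{m,*}(AK)\big)=V_{nm}\big(\Pi_\Phi^{m,*}K\big).$$ -/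

import Mathlib

open MeasureTheory Set
open scoped ENNReal Matrix RealInnerProductSpace

namespace OrliczProjection

/-- The class `𝒞` of convex functions `Φ : M_{1,m}(ℝ) → [0, ∞)` with `Φ(o) = 0` and
`Φ(z) + Φ(-z) > 0` for `z ≠ o`. Row vectors `M_{1,m}(ℝ)` are written `Fin m → ℝ`. -/
structure IsOrliczFunction {m : ℕ} (Φ : (Fin m → ℝ) → ℝ) : Prop where
  convex : ConvexOn ℝ univ Φ
  nonneg : ∀ z, 0 ≤ Φ z
  map_zero : Φ 0 = 0
  pos : ∀ z, z ≠ 0 → 0 < Φ z + Φ (-z)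

/-- The inner product `tr (xᵀ y)` on the space `M_{n,m}(ℝ)` of real `n × m` matrices. -/
def matrixInner {n m : ℕ} (x y : Matrix (Fin n) (Fin m) ℝ) : ℝ :=
  (xᵀ * y).trace

/-- Lebesgue measure of a subset of `M_{n,m}(ℝ)`, whose entries are identified with `ℝ^{nm}`. -/
noncomputable def matrixVolume {n m : ℕ} (S : Set (Matrix (Fin n) (Fin m) ℝ)) : ℝ≥0∞ :=
  volume ((Matrix.of : (Fin n → Fin m → ℝ) ≃ Matrix (Fin n) (Fin m) ℝ) ⁻¹' S)

/-- The support function `h_K(x) = max {x · y : y ∈ K}` of a convex body `K` in `ℝⁿ = M_{n,1}(ℝ)`. -/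
noncomputable def supportFun {n : ℕ} (K : Set (EuclideanSpace ℝ (Fin n)))
    (x : EuclideanSpace ℝ (Fin n)) : ℝ :=
  sSup ((fun y => ⟪x, y⟫) '' K)

/-- `u` is an outer unit normal vector of the convex set `K` at the point `y`. -/
def IsOuterUnitNormal {n : ℕ} (K : Set (EuclideanSpace ℝ (Fin n)))
    (y u : EuclideanSpace ℝ (Fin n)) : Prop :=
  ‖u‖ = 1 ∧ ∀ z ∈ K, ⟪u, z⟫ ≤ ⟪u, y⟫

open Classical in
/-- `ν_K(y)`: an outer unit normal vector of `K` at `y`. Every boundary point of a convex body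
has one, and at `ℋ^{n-1}`-almost every boundary point it is unique, so the choice made at the
other points is immaterial. -/
noncomputable def gaussMap {n : ℕ} (K : Set (EuclideanSpace ℝ (Fin n)))
    (y : EuclideanSpace ℝ (Fin n)) : EuclideanSpace ℝ (Fin n) :=
  if h : ∃ u, IsOuterUnitNormal K y u then h.choose else 0

/-- The surface area measure `S_K(η) = ℋ^{n-1}(ν_K⁻¹(η))`, where `ν_K` is defined on `∂K`, as a
measure on `ℝⁿ` concentrated on the unit sphere. Here `ℋ^{n-1}` is the Hausdorff measure in its
usual normalization, which agrees with Lebesgue measure in dimension `n - 1`. -/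
noncomputable def surfaceAreaMeasure {n : ℕ} (K : Set (EuclideanSpace ℝ (Fin n))) :
    Measure (EuclideanSpace ℝ (Fin n)) :=
  ((μHE[n - 1] : Measure (EuclideanSpace ℝ (Fin n))).restrict (frontier K)).map (gaussMap K)

/-- `H_x(t) = ∫_{S^{n-1}} Φ(t (uᵀ x) / h_K(u)) h_K(u) dS_K(u)`; the integrand is nonnegative. -/
noncomputable def orliczIntegral {n m : ℕ} (Φ : (Fin m → ℝ) → ℝ)
    (K : Set (EuclideanSpace ℝ (Fin n))) (x : Matrix (Fin n) (Fin m) ℝ) (t : ℝ) : ℝ≥0∞ :=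
  ∫⁻ u in Metric.sphere (0 : EuclideanSpace ℝ (Fin n)) 1,
    ENNReal.ofReal (Φ ((t / supportFun K u) • (u.ofLp ᵥ* x)) * supportFun K u)
      ∂(surfaceAreaMeasure K)

/-- The function `x ↦ inf {1/t > 0 : H_x(t) ≤ n V_n(K)}` on `M_{n,m}(ℝ)`, which is the support
function of the `m`th order Orlicz projection body of `K`. Its value at the origin is `0`,
since `H_o = 0`. -/
noncomputable def projectionSupport {n m : ℕ} (Φ : (Fin m → ℝ) → ℝ)
    (K : Set (EuclideanSpace ℝ (Fin n))) (x : Matrix (Fin n) (Fin m) ℝ) : ℝ :=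
  sInf {s : ℝ | ∃ t : ℝ, 0 < t ∧ s = 1 / t ∧ orliczIntegral Φ K x t ≤ n * volume K}

/-- The `m`th order Orlicz projection body `Π_Φ^m K`: the convex body in `M_{n,m}(ℝ)` determined
by the support function `projectionSupport Φ K`, that is, the intersection of the half-spaces
`{y | x · y ≤ h(x)}`. -/
def projectionBody {n m : ℕ} (Φ : (Fin m → ℝ) → ℝ)
    (K : Set (EuclideanSpace ℝ (Fin n))) : Set (Matrix (Fin n) (Fin m) ℝ) :=
  {y | ∀ x : Matrix (Fin n) (Fin m) ℝ, matrixInner x y ≤ projectionSupport Φ K x}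

/-- The polar body `L* = {x : x · y ≤ 1 for all y ∈ L}` in `M_{n,m}(ℝ)`. -/
def polarBody {n m : ℕ} (L : Set (Matrix (Fin n) (Fin m) ℝ)) : Set (Matrix (Fin n) (Fin m) ℝ) :=
  {x | ∀ y ∈ L, matrixInner x y ≤ 1}

end OrliczProjection

/-!
Write `g` for the gauge function of `K`, `∇ g` for its gradient and `ℋ` for `(n-1)`-dimensional
Hausdorff measure. At a boundary point `y` where `g` is differentiable, the outer unit normal is
unique and equals `u = ∇ g y / ‖∇ g y‖`, while `h_K(u) = 1 / ‖∇ g y‖`. As the other boundary points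
form an `ℋ`-null set, the defining integral becomes
`H_x(t) = ∫_{∂K} Φ(t (∇ g(y))ᵀ x) ‖∇ g(y)‖⁻¹ dℋ(y)`
(`orliczIntegral_eq_setLIntegral_regularBoundary`). For a linear bijection `L`, the gauge of `L K`
has gradient `L⁻ᵀ ∇ g(y)` at `L y` (`gradient_gauge_image`), and `L` changes `ℋ` on `∂K` by the
factor `|det L| ‖L⁻ᵀ ν(y)‖`. When `|det L| = 1` this factor turns `‖L⁻ᵀ ∇ g(y)‖⁻¹` into
`‖∇ g(y)‖⁻¹`, so that `H_x(t)` for `L K` is `H_{L⁻¹ x}(t)` for `K`. The two claims follow by linear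
algebra, left multiplication by a matrix of determinant one preserving the volume of `M_{n,m}(ℝ)`.

Two facts from geometric measure theory carry the argument.

* The change of variables `lintegral_image_le`. Only an inequality is proved: applied to both `L`
  and `L⁻¹`, it gives the equality. A hyperplane is treated by comparing volumes of prisms through
  Fubini's theorem. The boundary of `K` is cut into countably many pieces on which the normal varies
  by at most `ε`; such a piece is nearly flat, since for two of its points `y`, `z` the inequalities
  `⟪ν y, z - y⟫ ≤ 0` and `⟪ν z, y - z⟫ ≤ 0` bound `⟪v, y - z⟫` by `ε ‖y - z‖` for any normal `v` of
  the piece. It can therefore be replaced by its projection to a hyperplane at the cost of a factor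
  tending to `1`.
* The boundary points where `g` is not differentiable are `ℋ`-null
  (`euclideanHausdorffMeasure_frontier_not_differentiableAt_gauge`). By Rademacher's theorem the
  non-differentiability set of `g` is a null cone, hence it has null sections with all affine
  hyperplanes that miss the origin, and radial projection onto `∂K` is Lipschitz on such sections.
-/

namespace OrliczProjection

open Module Filter Topology
open scoped NNReal Gradient Pointwise

/-! ### Hausdorff measure and linear images of hypersurfaces -/

/-- If distances between values of `f` are at most `C` times those between values of `g`, then
`f` factors through `g` by a `C`-Lipschitz map. -/
theorem euclideanHausdorffMeasure_image_le_of_dist_le {X Y Z : Type*} [Nonempty X]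
    [MetricSpace Y] [MeasurableSpace Y] [BorelSpace Y]
    [MetricSpace Z] [MeasurableSpace Z] [BorelSpace Z] (d : ℕ) (C : ℝ≥0) {s : Set X}
    {f : X → Y} {g : X → Z} (h : ∀ x ∈ s, ∀ y ∈ s, dist (f x) (f y) ≤ C * dist (g x) (g y)) :
    μHE[d] (f '' s) ≤ (C : ℝ≥0∞) ^ d * μHE[d] (g '' s) := by
  have hinv : ∀ x ∈ s, Function.invFunOn g s (g x) ∈ s ∧ g (Function.invFunOn g s (g x)) = g x :=
    fun x hx => ⟨Function.invFunOn_mem ⟨x, hx, rfl⟩, Function.invFunOn_eq ⟨x, hx, rfl⟩⟩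
  have hlip : LipschitzOnWith C (f ∘ Function.invFunOn g s) (g '' s) := by
    refine LipschitzOnWith.of_dist_le_mul ?_
    rintro _ ⟨x, hx, rfl⟩ _ ⟨y, hy, rfl⟩
    have := h _ (hinv x hx).1 _ (hinv y hy).1
    rwa [(hinv x hx).2, (hinv y hy).2] at this
  have himg : f '' s = (f ∘ Function.invFunOn g s) '' (g '' s) := by
    rw [image_image]
    refine image_congr fun x hx => ?_
    have := h x hx _ (hinv x hx).1
    rw [(hinv x hx).2, dist_self, mul_zero] at this
    exact dist_le_zero.1 this
  have key := hlip.hausdorffMeasure_image_le (d := d) (Nat.cast_nonneg d)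
  rw [← himg, ENNReal.rpow_natCast] at key
  rw [Measure.euclideanHausdorffMeasure_def, Measure.euclideanHausdorffMeasure_def,
    Measure.smul_apply, Measure.smul_apply, mul_smul_comm]
  gcongr

variable {E : Type*} [NormedAddCommGroup E] [InnerProductSpace ℝ E] [FiniteDimensional ℝ E]
  [MeasurableSpace E] [BorelSpace E]

/-- Fubini's theorem for a prism: `T` consists of the translates of its base `S ⊆ vᗮ` by `r • c`,
`r ∈ [0, 1]`, where `⟪v, c⟫ = 1`; its edge `c` may be oblique, and its height is `‖v‖⁻¹`. -/
theorem euclideanHausdorffMeasure_eq_of_slices {v c : E} (hv : v ≠ 0) {T S : Set E}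
    (hT : MeasurableSet T) (hslice : ∀ y, y ∈ T ↔ ⟪v, y⟫ ∈ Icc (0 : ℝ) 1 ∧ y - ⟪v, y⟫ • c ∈ S)
    (hS : ∀ y ∈ S, ⟪v, y⟫ = 0) (hc : ⟪v, c⟫ = 1) :
    ‖v‖ₑ * μHE[finrank ℝ E] T = μHE[finrank ℝ E - 1] S := by
  have hv0 : (0 : ℝ) < ‖v‖ ^ 2 := by positivity
  have hsl : ∀ x : ℝ, μHE[finrank ℝ E - 1] (T ∩ AffineSubspace.mk' (x • v +ᵥ (0 : E)) (ℝ ∙ v)ᗮ) =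
      (Icc (0 : ℝ) (‖v‖ ^ 2)⁻¹).indicator (fun _ => μHE[finrank ℝ E - 1] S) x := by
    intro x
    have hmem : ∀ y : E, y ∈ AffineSubspace.mk' (x • v +ᵥ (0 : E)) (ℝ ∙ v)ᗮ ↔
        ⟪v, y⟫ = x * ‖v‖ ^ 2 := by
      intro y
      rw [AffineSubspace.mem_mk', Submodule.mem_orthogonal_singleton_iff_inner_right]
      simp [inner_sub_right, inner_smul_right, sub_eq_zero]
    have hx : x ∈ Icc (0 : ℝ) (‖v‖ ^ 2)⁻¹ ↔ x * ‖v‖ ^ 2 ∈ Icc (0 : ℝ) 1 := by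
      simp only [mem_Icc]
      rw [mul_nonneg_iff_of_pos_right hv0, ← le_div_iff₀ hv0, one_div]
    by_cases hxI : x ∈ Icc (0 : ℝ) (‖v‖ ^ 2)⁻¹
    · rw [indicator_of_mem hxI, ← measure_preimage_add_right _ (-((x * ‖v‖ ^ 2) • c)) S]
      congr 1
      ext y
      simp only [mem_inter_iff, SetLike.mem_coe, hmem, mem_preimage, hslice]
      constructor
      · rintro ⟨⟨_, h⟩, h'⟩
        rwa [h', sub_eq_add_neg] at h
      · intro h
        have h' : ⟪v, y⟫ = x * ‖v‖ ^ 2 := by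
          have := hS _ h
          rw [inner_add_right, inner_neg_right, inner_smul_right, hc] at this
          linarith
        rw [h']
        exact ⟨⟨hx.1 hxI, by rwa [sub_eq_add_neg]⟩, rfl⟩
    · rw [indicator_of_notMem hxI]
      convert measure_empty (μ := (μHE[finrank ℝ E - 1] : Measure E))
      ext y
      simp only [mem_inter_iff, SetLike.mem_coe, hmem, hslice, mem_empty_iff_false, iff_false]
      rintro ⟨⟨h, _⟩, h'⟩
      exact hxI (hx.2 (h' ▸ h))
  rw [EuclideanGeometry.euclideanHausdorffMeasure_eq_lintegral (0 : E) hv hT]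
  simp_rw [hsl]
  rw [lintegral_indicator measurableSet_Icc, setLIntegral_const, Real.volume_Icc, sub_zero,
    ← mul_assoc, mul_comm _ (ENNReal.ofReal _), ← mul_assoc, ← ofReal_norm,
    ← ENNReal.ofReal_mul (norm_nonneg _), ← ENNReal.ofReal_mul (by positivity), ← pow_two,
    mul_inv_cancel₀ hv0.ne', ENNReal.ofReal_one, one_mul]

/-- A linear bijection `L` scales the area of subsets of the hyperplane `vᗮ` by at most
`|det L| ‖L⁻ᵀ v‖`: the prism of height one over a set `S ⊆ vᗮ` is mapped to the prism with base `L S`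
and height `‖L⁻ᵀ v‖⁻¹`. -/
theorem euclideanHausdorffMeasure_image_le_of_subset_orthogonal (L : E ≃L[ℝ] E) {v : E}
    (hv : ‖v‖ = 1) {S : Set E} (hS : ∀ y ∈ S, ⟪v, y⟫ = 0) :
    μHE[finrank ℝ E - 1] (L '' S) ≤ ENNReal.ofReal |LinearMap.det (L : E →ₗ[ℝ] E)| *
      ‖ContinuousLinearMap.adjoint (L.symm : E →L[ℝ] E) v‖ₑ * μHE[finrank ℝ E - 1] S := by
  set w := ContinuousLinearMap.adjoint (L.symm : E →L[ℝ] E) v with hw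
  have hwin : ∀ y, ⟪w, L y⟫ = ⟪v, y⟫ := by
    intro y
    rw [hw, ContinuousLinearMap.adjoint_inner_left]
    simp
  have hv0 : v ≠ 0 := by rintro rfl; simp at hv
  have hvv : ⟪v, v⟫ = 1 := by rw [real_inner_self_eq_norm_sq, hv, one_pow]
  have hw0 : w ≠ 0 := by
    intro h
    have := hwin v
    rw [h, inner_zero_left, hvv] at this
    exact zero_ne_one this
  -- Fubini's theorem needs a measurable base, whereas `S` is arbitrary.
  set S' := toMeasurable μHE[finrank ℝ E - 1] S ∩ {y | ⟪v, y⟫ = 0} with hS'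
  have hS'm : MeasurableSet S' := (measurableSet_toMeasurable _ _).inter
    (measurableSet_eq_fun (by fun_prop) (by fun_prop))
  have hSS' : S ⊆ S' := fun y hy => ⟨subset_toMeasurable _ _ hy, hS y hy⟩
  have hμ : μHE[finrank ℝ E - 1] S' ≤ μHE[finrank ℝ E - 1] S :=
    (measure_mono inter_subset_left).trans (measure_toMeasurable _).le
  set T := {y : E | ⟪v, y⟫ ∈ Icc (0 : ℝ) 1 ∧ y - ⟪v, y⟫ • v ∈ S'} with hT
  have hTm : MeasurableSet T := by
    have h1 : Measurable fun y : E => ⟪v, y⟫ := by fun_prop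
    have h2 : Measurable fun y : E => y - ⟪v, y⟫ • v := by fun_prop
    exact (h1 measurableSet_Icc).inter (h2 hS'm)
  have e1 := euclideanHausdorffMeasure_eq_of_slices hv0 hTm (c := v) (S := S') (fun y => Iff.rfl)
    (fun y hy => hy.2) hvv
  have hLT : MeasurableSet (L '' T) := L.toHomeomorph.measurableEmbedding.measurableSet_image.2 hTm
  have e2 := euclideanHausdorffMeasure_eq_of_slices hw0 hLT (c := L v) (S := L '' S') (by
    intro z
    obtain ⟨y, rfl⟩ := L.surjective z
    rw [hwin, ← map_smul, ← map_sub, L.injective.mem_set_image, L.injective.mem_set_image]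
    rfl) (by
    rintro _ ⟨y, hy, rfl⟩
    rw [hwin]; exact hy.2) (by rw [hwin, hvv])
  have e3 : μHE[finrank ℝ E] (L '' T) =
      ENNReal.ofReal |LinearMap.det (L : E →ₗ[ℝ] E)| * μHE[finrank ℝ E] T :=
    Measure.addHaar_image_linearMap _ (L : E →ₗ[ℝ] E) T
  calc μHE[finrank ℝ E - 1] (L '' S) ≤ μHE[finrank ℝ E - 1] (L '' S') :=
        measure_mono (image_mono hSS')
    _ = ENNReal.ofReal |LinearMap.det (L : E →ₗ[ℝ] E)| * ‖w‖ₑ * μHE[finrank ℝ E - 1] S' := by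
        rw [← e2, ← e1, e3, ← ofReal_norm v, hv, ENNReal.ofReal_one, one_mul]
        ring
    _ ≤ _ := by gcongr

/-- The area scaling bound for a set that is nearly parallel to the hyperplane `vᗮ`. Writing `P` for
the orthogonal projection onto `vᗮ`, the set `P s` is no larger than `s`, and `L s` is the image of
`L (P s)` under a map with Lipschitz constant `(1 - ε ‖L‖ ‖L⁻¹‖)⁻¹`. -/
theorem euclideanHausdorffMeasure_image_le_of_inner_le (L : E ≃L[ℝ] E) {v : E}
    (hv : ‖v‖ = 1) {ε : ℝ} (hε : 0 ≤ ε)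
    (hεL : ε * (‖(L : E →L[ℝ] E)‖ * ‖(L.symm : E →L[ℝ] E)‖) < 1)
    {s : Set E} (hs : ∀ y ∈ s, ∀ z ∈ s, |⟪v, y - z⟫| ≤ ε * ‖y - z‖) :
    μHE[finrank ℝ E - 1] (L '' s) ≤
      ENNReal.ofReal ((1 - ε * (‖(L : E →L[ℝ] E)‖ * ‖(L.symm : E →L[ℝ] E)‖))⁻¹ ^
          (finrank ℝ E - 1)) *
        (ENNReal.ofReal |LinearMap.det (L : E →ₗ[ℝ] E)| *
      ‖ContinuousLinearMap.adjoint (L.symm : E →L[ℝ] E) v‖ₑ * μHE[finrank ℝ E - 1] s) := by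
  set κ := ‖(L : E →L[ℝ] E)‖ * ‖(L.symm : E →L[ℝ] E)‖
  set P : E → E := fun y => y - ⟪v, y⟫ • v with hP
  have hPsub : ∀ y z, P y - P z = (y - z) - ⟪v, y - z⟫ • v := by
    intro y z
    simp only [hP, inner_sub_right, sub_smul]
    abel
  have hpos : 0 < 1 - ε * κ := by linarith
  have h1 : μHE[finrank ℝ E - 1] (L '' s) ≤
      ((1 - ε * κ)⁻¹.toNNReal : ℝ≥0∞) ^ (finrank ℝ E - 1) *
        μHE[finrank ℝ E - 1] ((L ∘ P) '' s) := by
    refine euclideanHausdorffMeasure_image_le_of_dist_le _ _ fun y hy z hz => ?_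
    rw [Real.coe_toNNReal _ (inv_nonneg.2 hpos.le), dist_eq_norm, dist_eq_norm, inv_mul_eq_div,
      le_div_iff₀ hpos, Function.comp_apply, Function.comp_apply, ← map_sub L y z,
      ← map_sub L (P y) (P z), hPsub]
    set δ := y - z
    rw [map_sub L δ, map_smul]
    have a1 : ‖δ‖ ≤ ‖(L.symm : E →L[ℝ] E)‖ * ‖L δ‖ := by
      simpa using (L.symm : E →L[ℝ] E).le_opNorm (L δ)
    have a2 : ‖L v‖ ≤ ‖(L : E →L[ℝ] E)‖ := by
      simpa [hv] using (L : E →L[ℝ] E).le_opNorm v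
    have a3 : ‖⟪v, δ⟫ • L v‖ ≤ ε * κ * ‖L δ‖ := by
      rw [norm_smul, Real.norm_eq_abs]
      calc |⟪v, δ⟫| * ‖L v‖ ≤ (ε * (‖(L.symm : E →L[ℝ] E)‖ * ‖L δ‖)) * ‖(L : E →L[ℝ] E)‖ := by
            gcongr
            exact (hs y hy z hz).trans (by gcongr)
        _ = _ := by ring
    have a4 := norm_sub_norm_le (L δ) (⟪v, δ⟫ • L v)
    linarith
  have h2 : μHE[finrank ℝ E - 1] (P '' s) ≤ μHE[finrank ℝ E - 1] s := by
    have := euclideanHausdorffMeasure_image_le_of_dist_le (finrank ℝ E - 1) 1 (s := s) (f := P)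
      (g := id) (fun y _ z _ => ?_)
    · simpa using this
    rw [dist_eq_norm, dist_eq_norm, hPsub, NNReal.coe_one, one_mul]
    simp only [id]
    set δ := y - z
    have : ‖δ - ⟪v, δ⟫ • v‖ ^ 2 ≤ ‖δ‖ ^ 2 := by
      rw [norm_sub_sq_real, inner_smul_right, norm_smul, hv, real_inner_comm, mul_one,
        Real.norm_eq_abs, sq_abs]
      nlinarith [sq_nonneg ⟪v, δ⟫]
    exact (sq_le_sq₀ (norm_nonneg _) (norm_nonneg _)).1 this
  have h3 := euclideanHausdorffMeasure_image_le_of_subset_orthogonal L hv (S := P '' s) (by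
    rintro _ ⟨y, -, rfl⟩
    simp [hP, inner_sub_right, inner_smul_right, hv])
  rw [image_comp] at h1
  rw [ENNReal.ofReal_pow (inv_nonneg.2 hpos.le)]
  refine h1.trans ?_
  gcongr
  · exact le_rfl
  · exact h3.trans (by gcongr)

/-- The area scaling bound with an error factor depending on the mesh `ε` of a partition of `R`
according to the values of the normal field `ν`. -/
theorem euclideanHausdorffMeasure_image_le_mul_lintegral (L : E ≃L[ℝ] E) {ε : ℝ} (hε : 0 < ε)
    (hεL : ε * (‖(L : E →L[ℝ] E)‖ * ‖(L.symm : E →L[ℝ] E)‖) < 1)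
    {R : Set E} {ν : E → E} (hR : MeasurableSet R) (hν : Measurable ν)
    (hν1 : ∀ y ∈ R, ‖ν y‖ = 1) (hνR : ∀ y ∈ R, ∀ z ∈ R, ⟪ν y, z - y⟫ ≤ 0) :
    μHE[finrank ℝ E - 1] (L '' R) ≤
      ENNReal.ofReal ((1 - ε * (‖(L : E →L[ℝ] E)‖ * ‖(L.symm : E →L[ℝ] E)‖))⁻¹ ^
          (finrank ℝ E - 1) * (1 + ε * (‖(L : E →L[ℝ] E)‖ * ‖(L.symm : E →L[ℝ] E)‖))) *
        ∫⁻ y in R, ENNReal.ofReal |LinearMap.det (L : E →ₗ[ℝ] E)| *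
          ‖ContinuousLinearMap.adjoint (L.symm : E →L[ℝ] E) (ν y)‖ₑ ∂μHE[finrank ℝ E - 1] := by
  set κ := ‖(L : E →L[ℝ] E)‖ * ‖(L.symm : E →L[ℝ] E)‖
  set D := ENNReal.ofReal |LinearMap.det (L : E →ₗ[ℝ] E)|
  set M := ContinuousLinearMap.adjoint (L.symm : E →L[ℝ] E) with hM
  set c := (1 - ε * κ)⁻¹ ^ (finrank ℝ E - 1)
  have hc : 0 ≤ c := pow_nonneg (inv_nonneg.2 (by linarith)) _
  have hMn : ‖M‖ = ‖(L.symm : E →L[ℝ] E)‖ := LinearIsometryEquiv.norm_map _ _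
  have hlow : ∀ u : E, ‖u‖ ≤ ‖(L : E →L[ℝ] E)‖ * ‖M u‖ := by
    intro u
    have h : ContinuousLinearMap.adjoint (L : E →L[ℝ] E) (M u) = u := by
      refine ext_inner_right ℝ fun z => ?_
      rw [ContinuousLinearMap.adjoint_inner_left, ContinuousLinearMap.adjoint_inner_left]
      simp
    have := (ContinuousLinearMap.adjoint (L : E →L[ℝ] E)).le_opNorm (M u)
    rwa [h, LinearIsometryEquiv.norm_map] at this
  set B : ℕ → Set E := disjointed fun k => Metric.ball (TopologicalSpace.denseSeq E k) (ε / 2)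
  have hBm : ∀ k, MeasurableSet (B k) := fun k =>
    MeasurableSet.disjointed (fun _ => Metric.isOpen_ball.measurableSet) k
  have hBu : ⋃ k, B k = univ := by
    rw [iUnion_disjointed, eq_univ_iff_forall]
    intro y
    obtain ⟨k, hk⟩ := (TopologicalSpace.denseRange_denseSeq E).exists_dist_lt y (half_pos hε)
    exact mem_iUnion.2 ⟨k, hk⟩
  set p : ℕ → Set E := fun k => R ∩ ν ⁻¹' B k with hp
  have hpm : ∀ k, MeasurableSet (p k) := fun k => hR.inter (hν (hBm k))
  have hpu : R = ⋃ k, p k := by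
    simp only [hp]
    rw [← inter_iUnion, ← preimage_iUnion, hBu, preimage_univ, inter_univ]
  have hpd : Pairwise (Function.onFun Disjoint p) := fun i j hij =>
    ((disjoint_disjointed _ hij).preimage ν).mono inter_subset_right inter_subset_right
  have hpB : ∀ k, ∀ y ∈ p k, dist (ν y) (TopologicalSpace.denseSeq E k) < ε / 2 :=
    fun k y hy => disjointed_subset
      (fun k => Metric.ball (TopologicalSpace.denseSeq E k) (ε / 2)) k hy.2
  have hpiece : ∀ k, μHE[finrank ℝ E - 1] (L '' p k) ≤ ENNReal.ofReal (c * (1 + ε * κ)) *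
      ∫⁻ y in p k, D * ‖M (ν y)‖ₑ ∂μHE[finrank ℝ E - 1] := by
    intro k
    rcases (p k).eq_empty_or_nonempty with h | ⟨y₀, hy₀⟩
    · simp [h]
    have hclose : ∀ y ∈ p k, ‖ν y - ν y₀‖ ≤ ε := by
      intro y hy
      have h1 := hpB k y hy
      have h2 := hpB k y₀ hy₀
      have := dist_triangle_right (ν y) (ν y₀) (TopologicalSpace.denseSeq E k)
      rw [dist_eq_norm] at this
      linarith
    -- Monotonicity of the normals makes the piece flat up to the slope `ε`.
    have hflat : ∀ y ∈ p k, ∀ z ∈ p k, ⟪ν y₀, y - z⟫ ≤ ε * ‖y - z‖ := by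
      intro y hy z hz
      have h1 := hνR z hz.1 y hy.1
      have h2 := real_inner_le_norm (ν y₀ - ν z) (y - z)
      rw [inner_sub_left, norm_sub_rev] at h2
      have h3 : ‖ν z - ν y₀‖ * ‖y - z‖ ≤ ε * ‖y - z‖ := by
        gcongr
        exact hclose z hz
      linarith
    have h := euclideanHausdorffMeasure_image_le_of_inner_le L (hν1 y₀ hy₀.1) hε.le hεL
      (s := p k) (fun y hy z hz => abs_le.2 ⟨by
        have := hflat z hz y hy
        rw [← neg_sub y z, inner_neg_right, norm_neg] at this
        linarith, hflat y hy z hz⟩)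
    refine h.trans ?_
    rw [ENNReal.ofReal_mul hc, mul_assoc (ENNReal.ofReal c)]
    refine mul_le_mul' le_rfl ?_
    rw [← lintegral_const_mul' _ _ ENNReal.ofReal_ne_top, ← setLIntegral_const]
    refine setLIntegral_mono' (hpm k) fun y hy => ?_
    rw [mul_left_comm]
    gcongr
    rw [← ofReal_norm, ← ofReal_norm, ← ENNReal.ofReal_mul (by positivity)]
    refine ENNReal.ofReal_le_ofReal ?_
    -- `‖M u‖` is bounded below on unit vectors, so its variation on the piece is a relative error.
    have h1 : ‖M (ν y₀)‖ ≤ ‖M (ν y)‖ + ‖M (ν y - ν y₀)‖ := by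
      rw [map_sub]
      have := norm_sub_norm_le (M (ν y₀)) (M (ν y))
      rw [norm_sub_rev (M (ν y)) (M (ν y₀))]
      linarith
    have h2 : ‖M (ν y - ν y₀)‖ ≤ ‖M‖ * ε := M.le_opNorm_of_le (hclose y hy)
    have h3 := hlow (ν y)
    rw [hν1 y hy.1] at h3
    have h4 : ‖M‖ * ε * 1 ≤ ‖M‖ * ε * (‖(L : E →L[ℝ] E)‖ * ‖M (ν y)‖) := by gcongr
    rw [hMn] at h4 h2
    calc ‖M (ν y₀)‖ ≤ ‖M (ν y)‖ +
          ‖(L.symm : E →L[ℝ] E)‖ * ε * (‖(L : E →L[ℝ] E)‖ * ‖M (ν y)‖) := by linarith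
      _ = _ := by ring
  calc μHE[finrank ℝ E - 1] (L '' R) ≤ ∑' k, μHE[finrank ℝ E - 1] (L '' p k) := by
        conv_lhs => rw [hpu, image_iUnion]
        exact measure_iUnion_le _
    _ ≤ ∑' k, ENNReal.ofReal (c * (1 + ε * κ)) *
        ∫⁻ y in p k, D * ‖M (ν y)‖ₑ ∂μHE[finrank ℝ E - 1] := ENNReal.tsum_le_tsum hpiece
    _ = _ := by
        conv_rhs => rw [hpu]
        rw [ENNReal.tsum_mul_left, lintegral_iUnion hpm hpd]

/-- Under a linear bijection `L`, the area of a set `R` with a unit normal field `ν` that supports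
`R` at each of its points grows at most by the density `|det L| ‖L⁻ᵀ ν‖`. -/
theorem euclideanHausdorffMeasure_image_le_lintegral (L : E ≃L[ℝ] E)
    {R : Set E} {ν : E → E} (hR : MeasurableSet R) (hν : Measurable ν)
    (hν1 : ∀ y ∈ R, ‖ν y‖ = 1) (hνR : ∀ y ∈ R, ∀ z ∈ R, ⟪ν y, z - y⟫ ≤ 0) :
    μHE[finrank ℝ E - 1] (L '' R) ≤
        ∫⁻ y in R, ENNReal.ofReal |LinearMap.det (L : E →ₗ[ℝ] E)| *
          ‖ContinuousLinearMap.adjoint (L.symm : E →L[ℝ] E) (ν y)‖ₑ ∂μHE[finrank ℝ E - 1] := by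
  set κ := ‖(L : E →L[ℝ] E)‖ * ‖(L.symm : E →L[ℝ] E)‖ with hκ
  have hlim : Tendsto (fun ε : ℝ => ENNReal.ofReal ((1 - ε * κ)⁻¹ ^ (finrank ℝ E - 1) *
      (1 + ε * κ))) (𝓝[>] 0) (𝓝 1) := by
    have : ContinuousAt (fun ε : ℝ => (1 - ε * κ)⁻¹ ^ (finrank ℝ E - 1) * (1 + ε * κ)) 0 := by
      refine ContinuousAt.mul (ContinuousAt.pow (ContinuousAt.inv₀ (by fun_prop) (by simp)) _)
        (by fun_prop)
    have h2 := (ENNReal.tendsto_ofReal this.tendsto).mono_left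
      (nhdsWithin_le_nhds (s := Ioi (0 : ℝ)))
    simpa using h2
  have hlim' := fun I : ℝ≥0∞ => ENNReal.Tendsto.mul_const (b := I) hlim (Or.inl one_ne_zero)
  simp only [one_mul] at hlim'
  refine ge_of_tendsto (hlim' _) ?_
  have hsmall : ∀ᶠ ε : ℝ in 𝓝[>] 0, ε * κ < 1 := by
    have : ContinuousAt (fun ε : ℝ => ε * κ) 0 := by fun_prop
    exact (this.eventually_lt_const (by simp)).filter_mono nhdsWithin_le_nhds
  filter_upwards [self_mem_nhdsWithin, hsmall] with ε hε hεκ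
  exact euclideanHausdorffMeasure_image_le_mul_lintegral L hε hεκ hR hν hν1 hνR

/-- One half of the change of variables formula for a linear bijection on a hypersurface with a
supporting unit normal field. -/
theorem lintegral_image_le (L : E ≃L[ℝ] E)
    {R : Set E} {ν : E → E} (hR : MeasurableSet R) (hν : Measurable ν)
    (hν1 : ∀ y ∈ R, ‖ν y‖ = 1) (hνR : ∀ y ∈ R, ∀ z ∈ R, ⟪ν y, z - y⟫ ≤ 0)
    {f : E → ℝ≥0∞} (hf : Measurable f) :
    ∫⁻ z in L '' R, f z ∂μHE[finrank ℝ E - 1] ≤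
      ∫⁻ y in R, ENNReal.ofReal |LinearMap.det (L : E →ₗ[ℝ] E)| *
          ‖ContinuousLinearMap.adjoint (L.symm : E →L[ℝ] E) (ν y)‖ₑ * f (L y)
            ∂μHE[finrank ℝ E - 1] := by
  set J : E → ℝ≥0∞ := fun y => ENNReal.ofReal |LinearMap.det (L : E →ₗ[ℝ] E)| *
    ‖ContinuousLinearMap.adjoint (L.symm : E →L[ℝ] E) (ν y)‖ₑ with hJ
  have hJm : Measurable J := by fun_prop
  have hLm : Measurable L := L.continuous.measurable
  have hle : (μHE[finrank ℝ E - 1] : Measure E).restrict (L '' R) ≤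
      (((μHE[finrank ℝ E - 1] : Measure E).restrict R).withDensity J).map L := by
    refine Measure.le_iff.2 fun B hB => ?_
    rw [Measure.restrict_apply hB, Measure.map_apply hLm hB, withDensity_apply _ (hLm hB),
      Measure.restrict_restrict (hLm hB), ← image_preimage_inter]
    exact euclideanHausdorffMeasure_image_le_lintegral L ((hLm hB).inter hR) hν
      (fun y hy => hν1 y hy.2) (fun y hy z hz => hνR y hy.2 z hz.2)
  refine (lintegral_mono' hle le_rfl).trans ?_
  rw [lintegral_map hf hLm]
  exact (lintegral_withDensity_eq_lintegral_mul _ hJm (hf.comp hLm)).le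

/-! ### Differentiability of the gauge at almost every boundary point -/

/-- The gauge of a bounded convex neighbourhood of the origin is differentiable at almost every
boundary point, with respect to area. -/
theorem euclideanHausdorffMeasure_frontier_not_differentiableAt_gauge {K : Set E}
    (hK : Convex ℝ K) (hKb : Bornology.IsBounded K) (hK0 : 0 ∈ interior K) :
    μHE[finrank ℝ E - 1] (frontier K ∩ {y | ¬ DifferentiableAt ℝ (gauge K) y}) = 0 := by
  have hnhds : K ∈ 𝓝 (0 : E) := mem_interior_iff_mem_nhds.1 hK0
  obtain ⟨C, hC⟩ := hK.lipschitz_gauge hnhds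
  set N : Set E := {y | ¬ DifferentiableAt ℝ (gauge K) y} with hN
  have hNm : MeasurableSet N := (measurableSet_of_differentiableAt ℝ (gauge K)).compl
  have hN0 : μHE[finrank ℝ E] N = 0 := ae_iff.1 hC.ae_differentiableAt
  have hNcone : ∀ (r : ℝ) (y : E), 0 < r → y ∈ N → r • y ∈ N := by
    intro r y hr hy hd
    refine hy ?_
    have h1 : DifferentiableAt ℝ (fun z : E => r⁻¹ • gauge K (r • z)) y :=
      (DifferentiableAt.comp y (f := fun z : E => r • z) hd (by fun_prop)).const_smul r⁻¹
    refine h1.congr_of_eventuallyEq (Eventually.of_forall fun z => ?_)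
    dsimp only
    rw [gauge_smul_of_nonneg hr.le, smul_smul, inv_mul_cancel₀ hr.ne', one_smul]
  -- Almost all sections of the null cone `N` orthogonal to `v` are null, and for positive heights
  -- these are dilates of each other.
  have hslice : ∀ v : E, v ≠ 0 → μHE[finrank ℝ E - 1] (N ∩ {y | ⟪v, y⟫ = 1}) = 0 := by
    intro v hv
    have hv2 : 0 < ‖v‖ ^ 2 := by positivity
    have h := EuclideanGeometry.euclideanHausdorffMeasure_eq_lintegral (0 : E) hv hNm
    rw [hN0, eq_comm, mul_eq_zero, or_iff_right (by simpa using hv)] at h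
    by_contra hne
    have hpos : ∀ x : ℝ, 0 < x →
        μHE[finrank ℝ E - 1] (N ∩ AffineSubspace.mk' (x • v +ᵥ (0 : E)) (ℝ ∙ v)ᗮ) =
          ‖x * ‖v‖ ^ 2‖₊ ^ (finrank ℝ E - 1) •
            μHE[finrank ℝ E - 1] (N ∩ {y | ⟪v, y⟫ = 1}) := by
      intro x hx
      have hxv : 0 < x * ‖v‖ ^ 2 := by positivity
      rw [← Measure.euclideanHausdorffMeasure_smul₀ _ hxv.ne']
      congr 1
      ext y
      rw [mem_smul_set_iff_inv_smul_mem₀ hxv.ne']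
      simp only [mem_inter_iff, SetLike.mem_coe, AffineSubspace.mem_mk',
        Submodule.mem_orthogonal_singleton_iff_inner_right, mem_ofPred_eq]
      refine and_congr ⟨hNcone _ _ (inv_pos.2 hxv), fun hy => ?_⟩ ?_
      · have := hNcone _ _ hxv hy
        rwa [smul_smul, mul_inv_cancel₀ hxv.ne', one_smul] at this
      · rw [inner_smul_right, inv_mul_eq_one₀ hxv.ne']
        simp [inner_sub_right, inner_smul_right, sub_eq_zero, eq_comm]
    set m := μHE[finrank ℝ E - 1] (N ∩ {y | ⟪v, y⟫ = 1})
    -- For `x ∈ [1, 2]` the section through `x • v` has area at least `(‖v‖²) ^ (dim E - 1) * m`.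
    have hlow : ((‖‖v‖ ^ 2‖₊ : ℝ≥0) ^ (finrank ℝ E - 1)) • m ≤ 0 := by
      rw [← h]
      calc ((‖‖v‖ ^ 2‖₊ : ℝ≥0) ^ (finrank ℝ E - 1)) • m
          = ∫⁻ _ in Icc (1 : ℝ) 2, ((‖‖v‖ ^ 2‖₊ : ℝ≥0) ^ (finrank ℝ E - 1)) • m := by
            rw [setLIntegral_const, Real.volume_Icc]
            norm_num
        _ ≤ ∫⁻ x in Icc (1 : ℝ) 2, μHE[finrank ℝ E - 1]
              (N ∩ AffineSubspace.mk' (x • v +ᵥ (0 : E)) (ℝ ∙ v)ᗮ) := by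
            refine setLIntegral_mono' measurableSet_Icc fun x hx => ?_
            rw [hpos x (by linarith [hx.1]), ENNReal.smul_def, ENNReal.smul_def]
            have : ‖‖v‖ ^ 2‖₊ ≤ ‖x * ‖v‖ ^ 2‖₊ := by
              rw [nnnorm_mul]
              refine le_mul_of_one_le_left zero_le ?_
              rw [← NNReal.coe_le_coe, coe_nnnorm, Real.norm_eq_abs]
              exact hx.1.trans (le_abs_self x)
            gcongr
        _ ≤ _ := setLIntegral_le_lintegral _ _
    rw [nonpos_iff_eq_zero, ENNReal.smul_def, smul_eq_mul, mul_eq_zero] at hlow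
    refine hlow.elim (fun h0 => ?_) hne
    rw [ENNReal.coe_eq_zero] at h0
    exact pow_ne_zero _ (nnnorm_ne_zero_iff.2 hv2.ne') h0
  obtain ⟨M, hM⟩ := hKb.closure.exists_norm_le
  have hcover : frontier K ∩ N ⊆
      ⋃ k, (frontier K ∩ N) ∩ {y | 0 < ⟪TopologicalSpace.denseSeq E k, y⟫} := by
    intro y hy
    have hy0 : y ≠ 0 := by
      rintro rfl
      exact hy.1.2 hK0
    have hopen : IsOpen {v : E | 0 < ⟪v, y⟫} := isOpen_lt (by fun_prop) (by fun_prop)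
    obtain ⟨k, hk⟩ := (TopologicalSpace.denseRange_denseSeq E).exists_mem_open hopen
      ⟨y, real_inner_self_pos.2 hy0⟩
    exact mem_iUnion.2 ⟨k, hy, hk⟩
  refine measure_mono_null hcover (measure_iUnion_null fun k => ?_)
  set v := TopologicalSpace.denseSeq E k
  set T := (frontier K ∩ N) ∩ {y | 0 < ⟪v, y⟫}
  have hvT : ∀ y ∈ T, ‖y‖ ≤ M ∧ 0 < ⟪v, y⟫ ∧ ⟪v, y⟫ ≤ ‖v‖ * M ∧ gauge K y = 1 := by
    intro y hy
    have h1 := hM y (frontier_subset_closure hy.1.1)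
    refine ⟨h1, hy.2, (real_inner_le_norm v y).trans (by gcongr), ?_⟩
    exact (gauge_eq_one_iff_mem_frontier hK hnhds).2 hy.1.1
  -- On `T`, the point `y` is recovered from `s = y / ⟪v, y⟫` as `s / gauge K s`, since
  -- `gauge K y = 1`.
  have hradial := euclideanHausdorffMeasure_image_le_of_dist_le (finrank ℝ E - 1)
    (‖v‖ * M * (1 + C * M)).toNNReal (s := T) (f := id) (g := fun y : E => (⟪v, y⟫)⁻¹ • y) (by
    intro y hy z hz
    obtain ⟨hy1, hy2, hy3, hy4⟩ := hvT y hy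
    obtain ⟨hz1, hz2, hz3, hz4⟩ := hvT z hz
    have hM0 : 0 ≤ M := (norm_nonneg y).trans hy1
    rw [Real.coe_toNNReal _ (by positivity)]
    set a := ⟪v, y⟫
    set b := ⟪v, z⟫
    have hg := hC.dist_le_mul (a⁻¹ • y) (b⁻¹ • z)
    set δ := dist (a⁻¹ • y) (b⁻¹ • z) with hδ
    rw [gauge_smul_of_nonneg (inv_nonneg.2 hy2.le), gauge_smul_of_nonneg (inv_nonneg.2 hz2.le),
      hy4, hz4, smul_eq_mul, smul_eq_mul, mul_one, mul_one, Real.dist_eq] at hg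
    have hsplit : y - z = a • (a⁻¹ • y - b⁻¹ • z) + (a * (b⁻¹ - a⁻¹)) • z := by
      rw [smul_sub, smul_smul, mul_inv_cancel₀ hy2.ne', one_smul, smul_smul, mul_sub,
        mul_inv_cancel₀ hy2.ne', sub_smul, one_smul]
      abel
    simp only [id]
    rw [dist_eq_norm, hsplit]
    refine (norm_add_le _ _).trans ?_
    rw [norm_smul, norm_smul, norm_mul, Real.norm_of_nonneg hy2.le, Real.norm_eq_abs,
      abs_sub_comm, ← dist_eq_norm, ← hδ]
    have hδ0 : 0 ≤ δ := dist_nonneg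
    calc a * δ + a * |a⁻¹ - b⁻¹| * ‖z‖ ≤ a * δ + a * (C * δ) * M := by gcongr
      _ = a * ((1 + C * M) * δ) := by ring
      _ ≤ (‖v‖ * M) * ((1 + C * M) * δ) := by gcongr
      _ = _ := by ring)
  rw [image_id] at hradial
  rcases T.eq_empty_or_nonempty with hT | ⟨y, hy⟩
  · rw [hT, measure_empty]
  have hv0 : v ≠ 0 := by
    intro h
    have := hy.2
    simp [h] at this
  have hsub : (fun y : E => (⟪v, y⟫)⁻¹ • y) '' T ⊆ N ∩ {y | ⟪v, y⟫ = 1} := by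
    rintro _ ⟨y, hy, rfl⟩
    have hy2 : 0 < ⟪v, y⟫ := hy.2
    refine ⟨hNcone _ _ (inv_pos.2 hy2) hy.1.2, ?_⟩
    rw [mem_ofPred_eq, inner_smul_right, inv_mul_cancel₀ hy2.ne']
  rw [measure_mono_null hsub (hslice v hv0), mul_zero] at hradial
  exact nonpos_iff_eq_zero.1 hradial

/-! ### Normals of a convex body and the gradient of its gauge -/

section Normals

variable {n : ℕ} {K : Set (EuclideanSpace ℝ (Fin n))}

theorem exists_isOuterUnitNormal (hK : Convex ℝ K) (hK0 : 0 ∈ interior K)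
    {y : EuclideanSpace ℝ (Fin n)} (hy : y ∈ frontier K) : ∃ u, IsOuterUnitNormal K y u := by
  obtain ⟨f, hf⟩ := geometric_hahn_banach_open_point hK.interior isOpen_interior hy.2
  set w := (InnerProductSpace.toDual ℝ (EuclideanSpace ℝ (Fin n))).symm f
  have hw : ∀ z, ⟪w, z⟫ = f z := fun z => InnerProductSpace.toDual_symm_apply
  have hw0 : w ≠ 0 := by
    intro h
    have := hf 0 hK0
    rw [← hw, ← hw, h, inner_zero_left, inner_zero_left] at this
    exact lt_irrefl _ this
  have hle : ∀ z ∈ K, ⟪w, z⟫ ≤ ⟪w, y⟫ := by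
    intro z hz
    have hcl : IsClosed {z | ⟪w, z⟫ ≤ ⟪w, y⟫} := isClosed_le (by fun_prop) (by fun_prop)
    refine closure_minimal (fun x hx => ?_) hcl
      ((hK.closure_interior_eq_closure_of_nonempty_interior ⟨0, hK0⟩).symm ▸ subset_closure hz)
    rw [mem_ofPred_eq, hw, hw]
    exact (hf x hx).le
  refine ⟨‖w‖⁻¹ • w, ?_, fun z hz => ?_⟩
  · rw [norm_smul, norm_inv, norm_norm, inv_mul_cancel₀ (norm_ne_zero_iff.2 hw0)]
  · rw [real_inner_smul_left, real_inner_smul_left]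
    exact mul_le_mul_of_nonneg_left (hle z hz) (inv_nonneg.2 (norm_nonneg _))

theorem isOuterUnitNormal_gaussMap (hK : Convex ℝ K) (hK0 : 0 ∈ interior K)
    {y : EuclideanSpace ℝ (Fin n)} (hy : y ∈ frontier K) :
    IsOuterUnitNormal K y (gaussMap K y) := by
  rw [gaussMap, dif_pos (exists_isOuterUnitNormal hK hK0 hy)]
  exact (exists_isOuterUnitNormal hK hK0 hy).choose_spec

theorem IsOuterUnitNormal.inner_pos {y u : EuclideanSpace ℝ (Fin n)}
    (hu : IsOuterUnitNormal K y u) (hK0 : 0 ∈ interior K) : 0 < ⟪u, y⟫ := by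
  obtain ⟨r, hr, hball⟩ := Metric.mem_nhds_iff.1 (mem_interior_iff_mem_nhds.1 hK0)
  have hmem : (r / 2) • u ∈ K := hball (by
    rw [mem_ball_zero_iff, norm_smul, hu.1, mul_one, Real.norm_of_nonneg (by positivity)]
    linarith)
  have := hu.2 _ hmem
  rw [inner_smul_right, real_inner_self_eq_norm_sq, hu.1] at this
  linarith

theorem IsOuterUnitNormal.inner_le_mul_gauge {y u : EuclideanSpace ℝ (Fin n)}
    (hu : IsOuterUnitNormal K y u) (hK0 : 0 ∈ interior K) (z : EuclideanSpace ℝ (Fin n)) :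
    ⟪u, z⟫ ≤ ⟪u, y⟫ * gauge K z := by
  have hpos := hu.inner_pos hK0
  rw [← div_le_iff₀' hpos]
  refine le_of_forall_gt_imp_ge_of_dense fun r hr => ?_
  obtain ⟨b, hb0, hbr, k, hk, rfl⟩ :=
    exists_lt_of_gauge_lt (absorbent_nhds_zero (mem_interior_iff_mem_nhds.1 hK0)) hr
  rw [div_le_iff₀ hpos]
  simp only [inner_smul_right]
  calc b * ⟪u, k⟫ ≤ b * ⟪u, y⟫ := by gcongr; exact hu.2 k hk
    _ ≤ r * ⟪u, y⟫ := by gcongr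

/-- The function `z ↦ ⟪u, y⟫ * gauge K z - ⟪u, z⟫` is nonnegative and vanishes at `y`, so its
derivative at `y` is zero. -/
theorem IsOuterUnitNormal.gradient_gauge {y u : EuclideanSpace ℝ (Fin n)}
    (hu : IsOuterUnitNormal K y u) (hK : Convex ℝ K) (hK0 : 0 ∈ interior K)
    (hy : y ∈ frontier K) (hd : DifferentiableAt ℝ (gauge K) y) :
    ∇ (gauge K) y = (⟪u, y⟫)⁻¹ • u := by
  have hpos := hu.inner_pos hK0
  have hy1 : gauge K y = 1 :=
    (gauge_eq_one_iff_mem_frontier hK (mem_interior_iff_mem_nhds.1 hK0)).2 hy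
  have hmin : IsLocalMin (fun z => ⟪u, y⟫ * gauge K z - innerSL ℝ u z) y := by
    refine Eventually.of_forall fun z => ?_
    have := hu.inner_le_mul_gauge hK0 z
    simp only [innerSL_apply_apply, hy1]
    linarith
  have hder := hmin.hasFDerivAt_eq_zero
    ((hd.hasFDerivAt.const_mul ⟪u, y⟫).sub (innerSL ℝ u).hasFDerivAt)
  refine ext_inner_right ℝ fun z => ?_
  rw [inner_gradient_left, real_inner_smul_left]
  have := congrArg (fun f => f z) hder
  simp only [sub_apply, smul_apply, innerSL_apply_apply, zero_apply, smul_eq_mul, sub_eq_zero] at this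
  rw [← this, inv_mul_cancel_left₀ hpos.ne']

theorem IsOuterUnitNormal.supportFun_eq {y u : EuclideanSpace ℝ (Fin n)}
    (hu : IsOuterUnitNormal K y u) (hy : y ∈ K) : supportFun K u = ⟪u, y⟫ :=
  IsGreatest.csSup_eq ⟨⟨y, hy, rfl⟩, by rintro _ ⟨z, hz, rfl⟩; exact hu.2 z hz⟩

/-- The boundary points of `K` at which the gauge of `K` is differentiable. -/
def regularBoundary (K : Set (EuclideanSpace ℝ (Fin n))) : Set (EuclideanSpace ℝ (Fin n)) :=
  frontier K ∩ {y | DifferentiableAt ℝ (gauge K) y}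

theorem measurableSet_regularBoundary : MeasurableSet (regularBoundary K) :=
  isClosed_frontier.measurableSet.inter (measurableSet_of_differentiableAt ℝ (gauge K))

theorem measurable_gradient (f : EuclideanSpace ℝ (Fin n) → ℝ) : Measurable (∇ f) :=
  (LinearIsometryEquiv.continuous _).measurable.comp (measurable_fderiv ℝ f)

/-- The normalized gradient of the gauge of `K`. On `regularBoundary K` it is the only outer unit
normal; elsewhere its value is irrelevant. Unlike `gaussMap`, it is measurable everywhere. -/
noncomputable def unitGradient (K : Set (EuclideanSpace ℝ (Fin n)))
    (y : EuclideanSpace ℝ (Fin n)) : EuclideanSpace ℝ (Fin n) :=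
  ‖∇ (gauge K) y‖⁻¹ • ∇ (gauge K) y

theorem measurable_unitGradient : Measurable (unitGradient K) := by
  have := measurable_gradient (gauge K)
  unfold unitGradient
  fun_prop

theorem IsOuterUnitNormal.norm_gradient_gauge {y u : EuclideanSpace ℝ (Fin n)}
    (hu : IsOuterUnitNormal K y u) (hK : Convex ℝ K) (hK0 : 0 ∈ interior K)
    (hy : y ∈ regularBoundary K) : ‖∇ (gauge K) y‖ = (⟪u, y⟫)⁻¹ := by
  rw [hu.gradient_gauge hK hK0 hy.1 hy.2, norm_smul, hu.1, mul_one,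
    Real.norm_of_nonneg (inv_nonneg.2 (hu.inner_pos hK0).le)]

theorem IsOuterUnitNormal.eq_unitGradient {y u : EuclideanSpace ℝ (Fin n)}
    (hu : IsOuterUnitNormal K y u) (hK : Convex ℝ K) (hK0 : 0 ∈ interior K)
    (hy : y ∈ regularBoundary K) : u = unitGradient K y := by
  rw [unitGradient, hu.norm_gradient_gauge hK hK0 hy, hu.gradient_gauge hK hK0 hy.1 hy.2,
    smul_smul, inv_inv, mul_inv_cancel₀ (hu.inner_pos hK0).ne', one_smul]

theorem isOuterUnitNormal_unitGradient (hK : Convex ℝ K) (hK0 : 0 ∈ interior K)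
    {y : EuclideanSpace ℝ (Fin n)} (hy : y ∈ regularBoundary K) :
    IsOuterUnitNormal K y (unitGradient K y) := by
  obtain ⟨u, hu⟩ := exists_isOuterUnitNormal hK hK0 hy.1
  rwa [← hu.eq_unitGradient hK hK0 hy]

theorem norm_gradient_gauge_pos (hK : Convex ℝ K) (hK0 : 0 ∈ interior K)
    {y : EuclideanSpace ℝ (Fin n)} (hy : y ∈ regularBoundary K) : 0 < ‖∇ (gauge K) y‖ := by
  have hu := isOuterUnitNormal_unitGradient hK hK0 hy
  rw [hu.norm_gradient_gauge hK hK0 hy]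
  exact inv_pos.2 (hu.inner_pos hK0)

theorem supportFun_unitGradient (hK : Convex ℝ K) (hKc : IsClosed K) (hK0 : 0 ∈ interior K)
    {y : EuclideanSpace ℝ (Fin n)} (hy : y ∈ regularBoundary K) :
    supportFun K (unitGradient K y) = ‖∇ (gauge K) y‖⁻¹ := by
  have hu := isOuterUnitNormal_unitGradient hK hK0 hy
  rw [hu.supportFun_eq (hKc.frontier_subset hy.1), hu.norm_gradient_gauge hK hK0 hy, inv_inv]

/-- The choice in `gaussMap` is immaterial: it only matters on a null set. -/
theorem surfaceAreaMeasure_eq_map_unitGradient (hK : Convex ℝ K) (hKc : IsCompact K)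
    (hK0 : 0 ∈ interior K) :
    surfaceAreaMeasure K =
      ((μHE[n - 1] : Measure (EuclideanSpace ℝ (Fin n))).restrict (regularBoundary K)).map
        (unitGradient K) := by
  have hres : (μHE[n - 1] : Measure (EuclideanSpace ℝ (Fin n))).restrict (frontier K) =
      (μHE[n - 1] : Measure (EuclideanSpace ℝ (Fin n))).restrict (regularBoundary K) := by
    refine Measure.restrict_congr_set (ae_eq_set.2 ⟨?_, ?_⟩)
    · have := euclideanHausdorffMeasure_frontier_not_differentiableAt_gauge hK hKc.isBounded hK0
      rw [finrank_euclideanSpace_fin] at this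
      rwa [regularBoundary, sdiff_self_inter]
    · rw [regularBoundary, sdiff_eq_empty.2 inter_subset_left, measure_empty]
  rw [surfaceAreaMeasure, hres]
  refine Measure.map_congr (ae_restrict_of_forall_mem measurableSet_regularBoundary fun y hy => ?_)
  exact (isOuterUnitNormal_gaussMap hK hK0 hy.1).eq_unitGradient hK hK0 hy

theorem continuous_supportFun (hKc : IsCompact K) : Continuous (supportFun K) :=
  hKc.continuous_sSup (f := fun x y => ⟪x, y⟫) (by
    simp only [Function.HasUncurry.uncurry, id]
    fun_prop)

/-! ### The defining integral as an integral over the boundary -/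

theorem orliczIntegral_eq_setLIntegral_regularBoundary {m : ℕ} {Φ : (Fin m → ℝ) → ℝ}
    (hΦ : Continuous Φ) (hK : Convex ℝ K) (hKc : IsCompact K) (hK0 : 0 ∈ interior K)
    (x : Matrix (Fin n) (Fin m) ℝ) (t : ℝ) :
    orliczIntegral Φ K x t = ∫⁻ y in regularBoundary K,
      ENNReal.ofReal (Φ (t • ((∇ (gauge K) y).ofLp ᵥ* x)) * ‖∇ (gauge K) y‖⁻¹) ∂μHE[n - 1] := by
  have hsm : Measurable (supportFun K) := (continuous_supportFun hKc).measurable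
  have hxm : Measurable fun u : EuclideanSpace ℝ (Fin n) => u.ofLp ᵥ* x := by
    refine Continuous.measurable ?_
    fun_prop
  have hf : Measurable fun u : EuclideanSpace ℝ (Fin n) =>
      ENNReal.ofReal (Φ ((t / supportFun K u) • (u.ofLp ᵥ* x)) * supportFun K u) := by
    refine ENNReal.measurable_ofReal.comp (Measurable.mul (hΦ.measurable.comp ?_) hsm)
    exact (measurable_const.div hsm).smul hxm
  have hsph : MeasurableSet (Metric.sphere (0 : EuclideanSpace ℝ (Fin n)) 1) :=
    Metric.isClosed_sphere.measurableSet
  rw [orliczIntegral, surfaceAreaMeasure_eq_map_unitGradient hK hKc hK0,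
    setLIntegral_map hsph hf measurable_unitGradient,
    Measure.restrict_restrict (measurable_unitGradient hsph)]
  have hsub : unitGradient K ⁻¹' Metric.sphere 0 1 ∩ regularBoundary K = regularBoundary K :=
    inter_eq_right.2 fun y hy => mem_sphere_zero_iff_norm.2
      (isOuterUnitNormal_unitGradient hK hK0 hy).1
  rw [hsub]
  refine setLIntegral_congr_fun measurableSet_regularBoundary fun y hy => ?_
  have hpos := norm_gradient_gauge_pos hK hK0 hy
  simp only [supportFun_unitGradient hK hKc.isClosed hK0 hy]
  rw [unitGradient, WithLp.ofLp_smul, Matrix.smul_vecMul, smul_smul, div_inv_eq_mul,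
    mul_inv_cancel_right₀ hpos.ne']

end Normals

/-! ### Linear images of a convex body -/

section LinearImages

variable {n : ℕ} {K : Set (EuclideanSpace ℝ (Fin n))}

theorem gauge_image (L : EuclideanSpace ℝ (Fin n) ≃L[ℝ] EuclideanSpace ℝ (Fin n)) :
    gauge (L '' K) = gauge K ∘ L.symm := by
  ext z
  obtain ⟨y, rfl⟩ := L.surjective z
  rw [Function.comp_apply, L.symm_apply_apply, gauge_def, gauge_def]
  congr 1
  ext r
  simp only [mem_ofPred_eq, ← image_smul_set, L.injective.mem_set_image]

theorem regularBoundary_image (L : EuclideanSpace ℝ (Fin n) ≃L[ℝ] EuclideanSpace ℝ (Fin n)) :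
    regularBoundary (L '' K) = L '' regularBoundary K := by
  have h : frontier (L '' K) = L '' frontier K := (L.toHomeomorph.image_frontier K).symm
  rw [regularBoundary, h]
  ext z
  obtain ⟨y, rfl⟩ := L.surjective z
  rw [mem_inter_iff, L.injective.mem_set_image, L.injective.mem_set_image, regularBoundary,
    mem_inter_iff, mem_ofPred_eq, mem_ofPred_eq, gauge_image, L.symm.comp_right_differentiableAt_iff,
    L.symm_apply_apply]

theorem gradient_gauge_image (L : EuclideanSpace ℝ (Fin n) ≃L[ℝ] EuclideanSpace ℝ (Fin n))
    (y : EuclideanSpace ℝ (Fin n)) :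
    ∇ (gauge (L '' K)) (L y) = ContinuousLinearMap.adjoint
      (L.symm : EuclideanSpace ℝ (Fin n) →L[ℝ] EuclideanSpace ℝ (Fin n)) (∇ (gauge K) y) := by
  refine ext_inner_right ℝ fun z => ?_
  rw [inner_gradient_left, gauge_image, L.symm.comp_right_fderiv, L.symm_apply_apply,
    ContinuousLinearMap.adjoint_inner_left, inner_gradient_left]
  rfl

theorem orliczIntegral_image_le {m : ℕ} {Φ : (Fin m → ℝ) → ℝ}
    (hΦ : Continuous Φ) (hK : Convex ℝ K) (hKc : IsCompact K) (hK0 : 0 ∈ interior K)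
    (L : EuclideanSpace ℝ (Fin n) ≃L[ℝ] EuclideanSpace ℝ (Fin n))
    (hL : |LinearMap.det (L : EuclideanSpace ℝ (Fin n) →ₗ[ℝ] EuclideanSpace ℝ (Fin n))| = 1)
    {x x' : Matrix (Fin n) (Fin m) ℝ}
    (hx : ∀ v, (ContinuousLinearMap.adjoint
      (L.symm : EuclideanSpace ℝ (Fin n) →L[ℝ] EuclideanSpace ℝ (Fin n)) v).ofLp ᵥ* x =
        v.ofLp ᵥ* x') (t : ℝ) :
    orliczIntegral Φ (L '' K) x t ≤ orliczIntegral Φ K x' t := by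
  have hLK : Convex ℝ (L '' K) :=
    hK.linear_image (L : EuclideanSpace ℝ (Fin n) →ₗ[ℝ] EuclideanSpace ℝ (Fin n))
  have hLK0 : (0 : EuclideanSpace ℝ (Fin n)) ∈ interior (L '' K) := by
    have h : interior (L '' K) = L '' interior K := (L.toHomeomorph.image_interior K).symm
    rw [h]
    exact ⟨0, hK0, map_zero L⟩
  rw [orliczIntegral_eq_setLIntegral_regularBoundary hΦ hLK
      (hKc.image L.continuous) hLK0,
    orliczIntegral_eq_setLIntegral_regularBoundary hΦ hK hKc hK0, regularBoundary_image]
  have hfm : Measurable fun z => ENNReal.ofReal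
      (Φ (t • ((∇ (gauge (L '' K)) z).ofLp ᵥ* x)) * ‖∇ (gauge (L '' K)) z‖⁻¹) := by
    have hg := measurable_gradient (gauge (L '' K))
    have hxm : Measurable fun u : EuclideanSpace ℝ (Fin n) => t • (u.ofLp ᵥ* x) := by
      refine Continuous.measurable ?_
      fun_prop
    exact ENNReal.measurable_ofReal.comp
      ((hΦ.measurable.comp (hxm.comp hg)).mul hg.norm.inv)
  have h := lintegral_image_le L measurableSet_regularBoundary
    (measurable_unitGradient (K := K))
    (fun y hy => (isOuterUnitNormal_unitGradient hK hK0 hy).1)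
    (fun y hy z hz => by
      have := (isOuterUnitNormal_unitGradient hK hK0 hy).2 z (hKc.isClosed.frontier_subset hz.1)
      rw [inner_sub_right]
      linarith) hfm
  rw [finrank_euclideanSpace_fin] at h
  refine h.trans (setLIntegral_mono' measurableSet_regularBoundary fun y hy => le_of_eq ?_)
  have hpos := norm_gradient_gauge_pos hK hK0 hy
  have hyL : L y ∈ regularBoundary (L '' K) := regularBoundary_image L ▸ mem_image_of_mem L hy
  have hLpos := norm_gradient_gauge_pos hLK hLK0 hyL
  rw [gradient_gauge_image] at hLpos
  rw [hL, ENNReal.ofReal_one, one_mul, gradient_gauge_image, hx, unitGradient, map_smul,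
    ← ofReal_norm, ← ENNReal.ofReal_mul (norm_nonneg _), norm_smul, norm_inv, norm_norm]
  congr 1
  field_simp

end LinearImages

/-! ### The action of matrices of determinant one -/

section MatrixAction

variable {n m : ℕ} {K : Set (EuclideanSpace ℝ (Fin n))}

/-- The continuous linear automorphism of `ℝⁿ` given by a matrix `B` of determinant one, with
inverse given by `B⁻¹`. -/
noncomputable def euclideanEquivOfDetEqOne (B : Matrix (Fin n) (Fin n) ℝ) (hB : B.det = 1) :
    EuclideanSpace ℝ (Fin n) ≃L[ℝ] EuclideanSpace ℝ (Fin n) :=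
  (LinearEquiv.ofLinearMap (Matrix.toEuclideanLin B) (Matrix.toEuclideanLin B⁻¹)
    (by rw [← Matrix.toLpLin_mul_same, Matrix.mul_nonsing_inv _ (hB ▸ isUnit_one),
      Matrix.toLpLin_one])
    (by rw [← Matrix.toLpLin_mul_same, Matrix.nonsing_inv_mul _ (hB ▸ isUnit_one),
      Matrix.toLpLin_one])).toContinuousLinearEquiv

theorem adjoint_symm_euclideanEquivOfDetEqOne_vecMul (B : Matrix (Fin n) (Fin n) ℝ)
    (hB : B.det = 1) (v : EuclideanSpace ℝ (Fin n)) (x : Matrix (Fin n) (Fin m) ℝ) :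
    (ContinuousLinearMap.adjoint ((euclideanEquivOfDetEqOne B hB).symm :
      EuclideanSpace ℝ (Fin n) →L[ℝ] EuclideanSpace ℝ (Fin n)) v).ofLp ᵥ* x =
      v.ofLp ᵥ* (B⁻¹ * x) := by
  have h : ContinuousLinearMap.adjoint ((euclideanEquivOfDetEqOne B hB).symm :
      EuclideanSpace ℝ (Fin n) →L[ℝ] EuclideanSpace ℝ (Fin n)) v =
      WithLp.toLp 2 (v.ofLp ᵥ* B⁻¹) := by
    refine ext_inner_right ℝ fun z => ?_
    rw [ContinuousLinearMap.adjoint_inner_left]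
    have : ((euclideanEquivOfDetEqOne B hB).symm :
      EuclideanSpace ℝ (Fin n) →L[ℝ] EuclideanSpace ℝ (Fin n)) z =
        WithLp.toLp 2 (B⁻¹ *ᵥ z.ofLp) := rfl
    rw [this, EuclideanSpace.inner_eq_star_dotProduct, EuclideanSpace.inner_eq_star_dotProduct]
    simp only [star_trivial]
    rw [dotProduct_comm, Matrix.dotProduct_mulVec, dotProduct_comm]
  rw [h, Matrix.vecMul_vecMul]

theorem orliczIntegral_toEuclideanLin_image {Φ : (Fin m → ℝ) → ℝ}
    (hΦ : Continuous Φ) (hK : Convex ℝ K) (hKc : IsCompact K) (hK0 : 0 ∈ interior K)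
    (B : Matrix (Fin n) (Fin n) ℝ) (hB : B.det = 1) (x : Matrix (Fin n) (Fin m) ℝ) (t : ℝ) :
    orliczIntegral Φ (Matrix.toEuclideanLin B '' K) x t = orliczIntegral Φ K (B⁻¹ * x) t := by
  -- The reverse inequality is this one for `B⁻¹` and the body `B K`.
  have hle : ∀ (B : Matrix (Fin n) (Fin n) ℝ) (hB : B.det = 1)
      {K : Set (EuclideanSpace ℝ (Fin n))}, Convex ℝ K → IsCompact K → 0 ∈ interior K →
      ∀ x : Matrix (Fin n) (Fin m) ℝ,
      orliczIntegral Φ (Matrix.toEuclideanLin B '' K) x t ≤ orliczIntegral Φ K (B⁻¹ * x) t := by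
    intro B hB K hK hKc hK0 x
    refine orliczIntegral_image_le hΦ hK hKc hK0 (euclideanEquivOfDetEqOne B hB) ?_
      (fun v => adjoint_symm_euclideanEquivOfDetEqOne_vecMul B hB v x) t
    have : LinearMap.det (euclideanEquivOfDetEqOne B hB :
        EuclideanSpace ℝ (Fin n) →ₗ[ℝ] EuclideanSpace ℝ (Fin n)) = B.det :=
      LinearMap.det_toLpLin 2 B
    rw [this, hB, abs_one]
  refine le_antisymm (hle B hB hK hKc hK0 x) ?_
  have hBu : IsUnit B.det := hB ▸ isUnit_one
  have hinv : (B⁻¹).det = 1 := by rw [Matrix.det_nonsing_inv, hB, Ring.inverse_one]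
  have hint : (0 : EuclideanSpace ℝ (Fin n)) ∈ interior (Matrix.toEuclideanLin B '' K) := by
    have h : interior (Matrix.toEuclideanLin B '' K) = Matrix.toEuclideanLin B '' interior K :=
      ((euclideanEquivOfDetEqOne B hB).toHomeomorph.image_interior K).symm
    rw [h]
    exact ⟨0, hK0, map_zero _⟩
  have h := hle B⁻¹ hinv (hK.linear_image (Matrix.toEuclideanLin B))
    (hKc.image (euclideanEquivOfDetEqOne B hB).continuous) hint (B⁻¹ * x)
  have himg : Matrix.toEuclideanLin B⁻¹ '' (Matrix.toEuclideanLin B '' K) = K := by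
    rw [← image_comp, ← LinearMap.coe_comp, ← Matrix.toLpLin_mul_same,
      Matrix.nonsing_inv_mul _ hBu, Matrix.toLpLin_one, LinearMap.id_coe, image_id]
  rwa [himg, Matrix.nonsing_inv_nonsing_inv _ hBu, Matrix.mul_nonsing_inv_cancel_left _ _ hBu] at h

theorem projectionSupport_toEuclideanLin_image {Φ : (Fin m → ℝ) → ℝ}
    (hΦ : Continuous Φ) (hK : Convex ℝ K) (hKc : IsCompact K) (hK0 : 0 ∈ interior K)
    (B : Matrix (Fin n) (Fin n) ℝ) (hB : B.det = 1) (x : Matrix (Fin n) (Fin m) ℝ) :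
    projectionSupport Φ (Matrix.toEuclideanLin B '' K) x = projectionSupport Φ K (B⁻¹ * x) := by
  have hvol : volume (Matrix.toEuclideanLin B '' K) = volume K := by
    rw [Measure.addHaar_image_linearMap, LinearMap.det_toLpLin, hB, abs_one, ENNReal.ofReal_one,
      one_mul]
  simp only [projectionSupport, hvol, orliczIntegral_toEuclideanLin_image hΦ hK hKc hK0 B hB]

theorem matrixInner_mul_left (B : Matrix (Fin n) (Fin n) ℝ) (x y : Matrix (Fin n) (Fin m) ℝ) :
    matrixInner (B * x) y = matrixInner x (Bᵀ * y) := by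
  rw [matrixInner, matrixInner, Matrix.transpose_mul, Matrix.mul_assoc]

theorem projectionBody_toEuclideanLin_image {Φ : (Fin m → ℝ) → ℝ}
    (hΦ : Continuous Φ) (hK : Convex ℝ K) (hKc : IsCompact K) (hK0 : 0 ∈ interior K)
    (B : Matrix (Fin n) (Fin n) ℝ) (hB : B.det = 1) :
    projectionBody Φ (Matrix.toEuclideanLin B '' K) =
      (fun y : Matrix (Fin n) (Fin m) ℝ => (Bᵀ)⁻¹ * y) '' projectionBody Φ K := by
  have hBu : IsUnit B.det := hB ▸ isUnit_one
  have hBtu : IsUnit Bᵀ.det := by rwa [Matrix.det_transpose]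
  ext y
  constructor
  · intro hy
    refine ⟨Bᵀ * y, fun x => ?_, Matrix.nonsing_inv_mul_cancel_left _ _ hBtu⟩
    have := hy (B * x)
    rwa [projectionSupport_toEuclideanLin_image hΦ hK hKc hK0 B hB,
      Matrix.nonsing_inv_mul_cancel_left _ _ hBu, matrixInner_mul_left] at this
  · rintro ⟨y, hy, rfl⟩ x
    rw [projectionSupport_toEuclideanLin_image hΦ hK hKc hK0 B hB]
    refine le_of_eq_of_le ?_ (hy (B⁻¹ * x))
    rw [matrixInner_mul_left, Matrix.transpose_nonsing_inv]

theorem polarBody_image_mul_left (B : Matrix (Fin n) (Fin n) ℝ) (hB : IsUnit B.det)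
    (S : Set (Matrix (Fin n) (Fin m) ℝ)) :
    polarBody ((fun y => (Bᵀ)⁻¹ * y) '' S) = (fun x => B * x) '' polarBody S := by
  ext x
  simp only [polarBody, mem_ofPred_eq, forall_mem_image]
  constructor
  · intro hx
    refine ⟨B⁻¹ * x, fun y hy => ?_, Matrix.mul_nonsing_inv_cancel_left _ _ hB⟩
    rw [matrixInner_mul_left, Matrix.transpose_nonsing_inv]
    exact hx hy
  · rintro ⟨x, hx, rfl⟩ y hy
    rw [matrixInner_mul_left, Matrix.mul_nonsing_inv_cancel_left _ _
      (by rwa [Matrix.det_transpose])]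
    exact hx y hy

theorem matrixVolume_image_mul_left (B : Matrix (Fin n) (Fin n) ℝ)
    (S : Set (Matrix (Fin n) (Fin m) ℝ)) :
    matrixVolume ((fun x => B * x) '' S) = ENNReal.ofReal (|B.det| ^ m) * matrixVolume S := by
  let e : (Fin m → Fin n → ℝ) ≃ₗ[ℝ] (Fin n → Fin m → ℝ) :=
    Matrix.transposeLinearEquiv (Fin m) (Fin n) ℝ ℝ
  let f : (Fin m → Fin n → ℝ) →ₗ[ℝ] (Fin m → Fin n → ℝ) :=
    LinearMap.pi fun j => (Matrix.toLin' B) ∘ₗ LinearMap.proj j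
  have himg : (Matrix.of : (Fin n → Fin m → ℝ) ≃ Matrix (Fin n) (Fin m) ℝ) ⁻¹'
      ((fun x => B * x) '' S) = (e.toLinearMap ∘ₗ f ∘ₗ e.symm.toLinearMap) ''
        ((Matrix.of : (Fin n → Fin m → ℝ) ≃ Matrix (Fin n) (Fin m) ℝ) ⁻¹' S) := rfl
  rw [matrixVolume, himg, Measure.addHaar_image_linearMap, LinearMap.det_conj, LinearMap.det_pi]
  simp [matrixVolume, abs_pow]

end MatrixAction
end OrliczProjection

theorem proposition4p3 (n m : ℕ) (hn : 1 ≤ n) (hm : 1 ≤ m)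
    (Φ : (Fin m → ℝ) → ℝ) (hΦ : OrliczProjection.IsOrliczFunction Φ)
    (K : Set (EuclideanSpace ℝ (Fin n)))
    (hKconvex : Convex ℝ K) (hKcompact : IsCompact K) (hKzero : 0 ∈ interior K)
    (A : Matrix.SpecialLinearGroup (Fin n) ℝ) :
    OrliczProjection.projectionBody Φ
        (Matrix.toEuclideanLin (A : Matrix (Fin n) (Fin n) ℝ) '' K) =
      (fun y : Matrix (Fin n) (Fin m) ℝ => ((A : Matrix (Fin n) (Fin n) ℝ)ᵀ)⁻¹ * y) ''
        OrliczProjection.projectionBody Φ K ∧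
    OrliczProjection.matrixVolume
        (OrliczProjection.polarBody (OrliczProjection.projectionBody Φ
          (Matrix.toEuclideanLin (A : Matrix (Fin n) (Fin n) ℝ) '' K))) =
      OrliczProjection.matrixVolume
        (OrliczProjection.polarBody (OrliczProjection.projectionBody Φ K)) := by
  have hΦc : Continuous Φ := continuousOn_univ.1 (hΦ.convex.continuousOn isOpen_univ)
  have hbody := OrliczProjection.projectionBody_toEuclideanLin_image hΦc hKconvex hKcompact hKzero
    (A : Matrix (Fin n) (Fin n) ℝ) A.det_coe
  refine ⟨hbody, ?_⟩
  rw [hbody, OrliczProjection.polarBody_image_mul_left _ (by rw [A.det_coe]; exact isUnit_one),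
    OrliczProjection.matrixVolume_image_mul_left, A.det_coe, abs_one, one_pow, ENNReal.ofReal_one,
    one_mul]
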